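/- Let $q$ be an indeterminate. For $n\ge 0$ put $[n]_q=1+q+\cdots+q^{n-1}$ (so $[0]_q=0$), $[n]_q!=\prod_{j=1}^n[j]_q$, $\binom{n}{k}_q=\frac{[n]_q!}{[k]_q!\,[n-k]_q!}$ for $0\le k\le n$, and $\binom{n}{k}_q=0$ for $k>n$. Let $t_{n,k}(q)=\binom{n}{k}_q([n]_q)^{n-k}$ for $0\le k\le n$ and $t_{n,k}(q)=0$ for $k>n$ (the entries of the $q$-trees matrix). Let $\mathcal F^*_{n+1,k+1}$ be the set of forests of rooted labelled trees on the vertex set $\{1,\dots,n+1\}$ with $k+1$ components in which the vertex $n+1$ is a leaf, i.e. has no children (a root without children counts as a leaf). For such a forest $F$ let $V_r(F)$ be the set of its roots, and let $v_{\min}$ be the lowest-numbered vertex among all children of roots (it exists exactly when $F$ has a non-root vertex). Let $V_t(F)$ be the set of vertices that are neither roots nor equal to $v_{\min}$; it has $\max(n-k-1,0)$ elements. Define - $\mathrm{niblings}(F)=\sum_{v\in V_r(F)}\#\{v' : v'\notin V_r(F),\ v'<v\}$; - $\mathrm{scindex}(F)=j$, where $v_0<v_1<\cdots<v_k$ are the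 roots of $F$ and $v_j$ is the parent of $v_{\min}$, and $\mathrm{scindex}(F)=0$ if $v_{\min}$ does not exist; - $\mathrm{parents}(F)=\sum_{v\in V_t(F)}p(v)$, where $p(v)$ is the label of the parent of $v$. Then for all integers $n,k\ge 0$ $$t_{n,k}(q)=\sum_{F\in\mathcal F^*_{n+1,k+1}}q^{\,\mathrm{niblings}(F)+\mathrm{scindex}(F)+\mathrm{parents}(F)-\max(n-k-1,\,0)}=\binom{n}{k}_q([n]_q)^{n-k},$$ where for $k>n$ the right-hand side is read as $0$. Equivalently, the exponent is $\mathrm{niblings}(F)+\mathrm{scindex}(F)+\sum_{v\in V_t(F)}(p(v)-1)$. -/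

import Mathlib

/-- A forest of rooted labelled trees on `m` vertices, given by its parent function:
`parent v = none` when `v` is a root, and following parents from any vertex one eventually
runs past a root. The vertex `v : Fin m` carries the label `v + 1`, so that the labels
are `1, …, m` and the order of the labels is the order of `Fin m`. -/
@[ext]
structure RootedForest (m : ℕ) where
  parent : Fin m → Option (Fin m)
  acyclic : ∀ v : Fin m, ∃ j : ℕ, (fun o : Option (Fin m) => o.bind parent)^[j] (some v) = none

namespace RootedForest

noncomputable instance instFintype (m : ℕ) : Fintype (RootedForest m) :=
  Fintype.ofInjective RootedForest.parent fun _ _ h => RootedForest.ext h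

variable {m : ℕ} (F : RootedForest m)

/-- The underlying undirected graph, each non-root being joined to its parent. -/
def graph : SimpleGraph (Fin m) :=
  SimpleGraph.fromRel fun v w => F.parent v = some w

/-- The number of connected components of the forest. -/
noncomputable def numComponents : ℕ :=
  Nat.card F.graph.ConnectedComponent

/-- A leaf is a vertex without children (so a root without children is a leaf, and a root
with a single child is not). -/
def IsLeaf (v : Fin m) : Prop :=
  ∀ w : Fin m, F.parent w ≠ some v

/-- `V_r(F)`: the roots of the components. -/
def roots : Finset (Fin m) :=
  {v | F.parent v = none}

/-- The children of the roots. -/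
def rootChildren : Finset (Fin m) :=
  {v | ∃ r ∈ F.roots, F.parent v = some r}

/-- `V_s(F) = {v_min}`, where `v_min` is the lowest-numbered vertex among the children of all
the roots; it is empty when `F` has no non-root vertex. -/
def smallestRootChild : Finset (Fin m) :=
  {v ∈ F.rootChildren | ∀ w ∈ F.rootChildren, v ≤ w}

/-- `V_t(F)`: the remaining vertices, neither a root nor `v_min`. -/
def remaining : Finset (Fin m) :=
  {v | v ∉ F.roots ∧ v ∉ F.smallestRootChild}

/-- `V_r(F, v)`: the non-root vertices that are lower-numbered than `v`. -/
def lowerNonroots (v : Fin m) : Finset (Fin m) :=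
  {w | w ∉ F.roots ∧ w < v}

/-- The sum, over all roots, of the number of lower-numbered non-root vertices. -/
def niblings : ℕ :=
  ∑ v ∈ F.roots, (F.lowerNonroots v).card

/-- The smallest child index: if the roots are `v_0 < v_1 < ⋯` and `v_j` is the parent of
`v_min`, this is `j`, the number of roots that are smaller than the parent of `v_min`; it is `0`
if there is no `v_min`. (The sum ranges over the at most one element `v_min` of `V_s(F)`.) -/
def scindex : ℕ :=
  ∑ v ∈ F.smallestRootChild, (F.roots.filter fun r => ∃ p, F.parent v = some p ∧ r < p).card

/-- The label (between `1` and `m`) of the parent of `v`; `0` if `v` is a root. -/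
def parentLabel (v : Fin m) : ℕ :=
  match F.parent v with
  | none => 0
  | some p => (p : ℕ) + 1

/-- The sum of the labels of the parents of the vertices in `V_t(F)`. -/
def parents : ℕ :=
  ∑ v ∈ F.remaining, F.parentLabel v

end RootedForest

open Classical in
/-- The forests on `n + 1` vertices with `k + 1` components in which vertex `n + 1` is a leaf. -/
noncomputable def leafForests (n k : ℕ) : Finset (RootedForest (n + 1)) :=
  {F | F.numComponents = k + 1 ∧ F.IsLeaf (Fin.last n)}

/-- The `q`-integer `1 + q + ⋯ + q ^ (n - 1)`, where `q` is the indeterminate of `ℚ(q)`. -/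
noncomputable def qInt (n : ℕ) : RatFunc ℚ :=
  ∑ i ∈ Finset.range n, RatFunc.X ^ i

/-- The `q`-factorial. -/
noncomputable def qFactorial (n : ℕ) : RatFunc ℚ :=
  ∏ j ∈ Finset.Icc 1 n, qInt j

/-- The `q`-binomial coefficient, which is `0` for `k > n`. -/
noncomputable def qBinomial (n k : ℕ) : RatFunc ℚ :=
  if k ≤ n then qFactorial n / (qFactorial k * qFactorial (n - k)) else 0

/-- The `(n, k)` entry of the `q`-trees matrix. -/
noncomputable def qTrees (n k : ℕ) : RatFunc ℚ :=
  qBinomial n k * qInt n ^ (n - k)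

/-! Fix a root set R that is not everything, and weight each non-root vertex by its parent. If a
parent p weighs x_p, the forests with roots R have total weight (∑_R x)(∑ x)^(|Rᶜ|-1)
(`forestSum_eq`): cutting off the set C of root children leaves a forest with roots R ∪ C in which R
is childless, so induction on |Rᶜ| and the binomial theorem (`sum_powerset_add_pow`) apply. Only the
total contribution of each C matters, so v_min may follow a rule of its own; this changes just the
factor ∑_R x (`sum_forests_eq`).

Take x_p = q^(p-1), and for v_min take q^(index of its parent among the roots), both replaced by 0
when the parent is n+1; this enforces the leaf condition. For k < n, R then contributes [j]_q
[n]_q^(n-k-1), with j the number of roots other than n+1. Niblings are inversions of R, so summing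
over R gives q-binomials (`sum_pow_compInv`). Splitting on n+1 ∈ R leaves [k+1]_q binom(n,k+1)_q +
q^(n-k) [k]_q binom(n,k)_q = [n]_q binom(n,k)_q. -/

open Finset

namespace RootedForest

/-! ### Ranks, roots and components of a forest -/

section Structure

variable {m : ℕ}

/-- The rank is the number of steps after which the chain of parents runs out. It supports induction
along parents and, through `ofRank`, surgery on forests. -/
theorem exists_rank (F : RootedForest m) :
    ∃ ρ : Fin m → ℕ, ∀ v w, F.parent v = some w → ρ w < ρ v := by
  classical
  refine ⟨fun v => Nat.find (F.acyclic v), fun v w h => ?_⟩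
  have hv := Nat.find_spec (F.acyclic v)
  cases hj : Nat.find (F.acyclic v) with
  | zero => rw [hj] at hv; simp at hv
  | succ j =>
    rw [hj, Function.iterate_succ_apply] at hv
    simp only [Option.bind_some, h] at hv
    simp only [hj]
    exact Nat.lt_succ_of_le (Nat.find_min' _ hv)

/-- A parent function along which some rank decreases is that of a forest. -/
def ofRank (p : Fin m → Option (Fin m)) (ρ : Fin m → ℕ)
    (h : ∀ v w, p v = some w → ρ w < ρ v) : RootedForest m where
  parent := p
  acyclic v := by
    induction hn : ρ v using Nat.strong_induction_on generalizing v with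
    | _ n ih =>
      cases hp : p v with
      | none => exact ⟨1, by simp [hp]⟩
      | some w =>
        obtain ⟨j, hj⟩ := ih _ (hn ▸ h v w hp) w rfl
        exact ⟨j + 1, by rw [Function.iterate_succ_apply]; simpa [hp] using hj⟩

variable (F : RootedForest m)

theorem mem_roots {v : Fin m} : v ∈ F.roots ↔ F.parent v = none := by
  simp [roots]

theorem mem_rootChildren {v : Fin m} :
    v ∈ F.rootChildren ↔ ∃ r ∈ F.roots, F.parent v = some r := by
  simp [rootChildren]

theorem rootChildren_subset : F.rootChildren ⊆ F.rootsᶜ := by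
  intro v hv
  obtain ⟨r, -, h⟩ := F.mem_rootChildren.1 hv
  simp [mem_roots, h]

theorem rootChildren_nonempty (h : F.rootsᶜ.Nonempty) : F.rootChildren.Nonempty := by
  obtain ⟨ρ, hρ⟩ := F.exists_rank
  obtain ⟨v, hv⟩ := h
  induction hn : ρ v using Nat.strong_induction_on generalizing v with
  | _ n ih =>
    cases hp : F.parent v with
    | none => simp [mem_roots, hp] at hv
    | some w =>
      by_cases hw : w ∈ F.roots
      · exact ⟨v, F.mem_rootChildren.2 ⟨w, hw, hp⟩⟩
      · exact ih _ (hn ▸ hρ v w hp) w (by simpa using hw) rfl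

/-- The map sending each vertex to its parent and fixing the roots. -/
def step (v : Fin m) : Fin m := (F.parent v).getD v

theorem iterate_step_root {v : Fin m} (hv : v ∈ F.roots) (j : ℕ) : F.step^[j] v = v :=
  Function.iterate_fixed (by simp [step, F.mem_roots.1 hv]) j

theorem iterate_step_mem_roots (ρ : Fin m → ℕ) (hρ : ∀ v w, F.parent v = some w → ρ w < ρ v)
    (N : ℕ) (v : Fin m) (hN : ρ v ≤ N) : F.step^[N] v ∈ F.roots := by
  induction N generalizing v with
  | zero =>
    rw [mem_roots]
    cases hp : F.parent v with
    | none => simpa using hp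
    | some w => have := hρ v w hp; omega
  | succ N ih =>
    cases hp : F.parent v with
    | none =>
      have hv : v ∈ F.roots := F.mem_roots.2 hp
      rwa [F.iterate_step_root hv]
    | some w =>
      have h := hρ v w hp
      have hs : F.step v = w := by simp [step, hp]
      rw [Function.iterate_succ_apply, hs]
      exact ih w (by omega)

theorem reachable_step (v : Fin m) : F.graph.Reachable v (F.step v) := by
  cases hp : F.parent v with
  | none => simp [step, hp]
  | some w =>
    obtain ⟨ρ, hρ⟩ := F.exists_rank
    have hne : v ≠ w := by
      rintro rfl
      exact lt_irrefl _ (hρ _ _ hp)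
    have hs : F.step v = w := by simp [step, hp]
    rw [hs]
    exact SimpleGraph.Adj.reachable (by simp [graph, hp, hne])

theorem reachable_iterate_step (j : ℕ) (v : Fin m) : F.graph.Reachable v (F.step^[j] v) := by
  induction j with
  | zero => simp
  | succ j ih =>
    rw [Function.iterate_succ_apply']
    exact ih.trans (F.reachable_step _)

theorem numComponents_eq : F.numComponents = F.roots.card := by
  obtain ⟨ρ, hρ⟩ := F.exists_rank
  set N := univ.sup ρ with hN
  have hroot (v : Fin m) : F.step^[N] v ∈ F.roots :=
    F.iterate_step_mem_roots ρ hρ N v (le_sup (mem_univ v))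
  have hstep (v w : Fin m) (h : F.parent v = some w) : F.step^[N] v = F.step^[N] w := by
    have hs : F.step v = w := by simp [step, h]
    -- The `N`-th iterate is a root, hence fixed by one more step; but `N + 1` steps from `v` are
    -- `N` steps from `w`.
    have h0 := F.iterate_step_root (hroot v) 1
    rw [Function.iterate_one, ← Function.iterate_succ_apply' F.step N v,
      Function.iterate_succ_apply, hs] at h0
    exact h0.symm
  have hreach (v w : Fin m) (h : F.graph.Reachable v w) : F.step^[N] v = F.step^[N] w := by
    obtain ⟨p⟩ := h
    induction p with
    | nil => rfl
    | cons hadj _ ih =>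
      rw [← ih]
      rcases (SimpleGraph.fromRel_adj _ _ _).1 hadj with ⟨-, h | h⟩
      · exact hstep _ _ h
      · exact (hstep _ _ h).symm
  rw [numComponents, ← Nat.card_eq_finsetCard]
  refine (Nat.card_eq_of_bijective
    (fun r : F.roots => F.graph.connectedComponentMk (r : Fin m)) ⟨fun r s h => ?_, fun c => ?_⟩).symm
  · have h := hreach _ _ (SimpleGraph.ConnectedComponent.exact h)
    rw [F.iterate_step_root r.2, F.iterate_step_root s.2] at h
    exact Subtype.ext h
  · induction c using SimpleGraph.ConnectedComponent.ind with
    | _ v =>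
      exact ⟨⟨_, hroot v⟩, SimpleGraph.ConnectedComponent.sound
        (F.reachable_iterate_step N v).symm⟩

/-- The forest in which the vertices of `C` are cut off from their parents. -/
def detach (C : Finset (Fin m)) : RootedForest m where
  parent v := if v ∈ C then none else F.parent v
  acyclic := by
    obtain ⟨ρ, hρ⟩ := F.exists_rank
    refine (ofRank (fun v => if v ∈ C then none else F.parent v) ρ fun v w h => ?_).acyclic
    by_cases hv : v ∈ C
    · simp [hv] at h
    · exact hρ v w (by simpa [hv] using h)

theorem detach_parent (C : Finset (Fin m)) (v : Fin m) :
    (F.detach C).parent v = if v ∈ C then none else F.parent v := rfl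

end Structure

/-! ### Forest sums weighted by parents -/

section Sums

variable {m : ℕ} {K : Type*} [CommRing K]

/-- The singleton choices off `C` turn maps `C → R` into total functions without adding terms. -/
theorem prod_sum_eq_sum_piFinset (C R : Finset (Fin m)) (Z : Fin m → Fin m → K) :
    ∏ c ∈ C, ∑ r ∈ R, Z c r =
      ∑ g ∈ Fintype.piFinset fun v => if v ∈ C then R else {v},
        ∏ v, if v ∈ C then Z v (g v) else 1 := by
  rw [← Finset.prod_univ_sum (fun v => if v ∈ C then R else {v})
    (fun v j => if v ∈ C then Z v j else 1), ← Finset.prod_subset (subset_univ C)]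
  · exact prod_congr rfl fun c hc => by simp [hc]
  · intro v _ hv
    simp [hv]

/-- Forests with roots `R` whose root children are `C` correspond to pairs of a map `C → R` and
a forest with roots `R ∪ C` in which the vertices of `R` have no children. -/
theorem sum_rootChildren_eq (R C : Finset (Fin m)) (hC : C ⊆ Rᶜ) (x : Fin m → K)
    (Z : Fin m → Fin m → K) :
    ∑ F : RootedForest m with F.roots = R ∧ F.rootChildren = C,
        ∏ v, (F.parent v).elim 1 (if v ∈ C then Z v else x) =
      (∏ c ∈ C, ∑ r ∈ R, Z c r) *
        ∑ F : RootedForest m with F.roots = R ∪ C ∧ ∀ v, ∀ w ∈ R, F.parent v ≠ some w,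
          ∏ v, (F.parent v).elim 1 x := by
  rw [prod_sum_eq_sum_piFinset, sum_mul_sum, ← sum_product']
  refine sum_nbij (fun F => (fun v => if v ∈ C then F.step v else v, F.detach C)) ?_ ?_ ?_ ?_
  · intro F hF
    obtain ⟨rfl, rfl⟩ := (mem_filter.1 hF).2
    simp only [mem_product, Fintype.mem_piFinset, mem_filter, mem_univ, true_and]
    refine ⟨fun v => ?_, ?_, fun v w hw h => ?_⟩
    · by_cases hv : v ∈ F.rootChildren
      · obtain ⟨r, hr, h⟩ := F.mem_rootChildren.1 hv
        simpa [hv, step, h] using hr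
      · simp [hv]
    · ext v
      by_cases hv : v ∈ F.rootChildren <;> simp [mem_roots, detach_parent, hv]
    · by_cases hv : v ∈ F.rootChildren
      · simp [detach_parent, hv] at h
      · rw [detach_parent, if_neg hv] at h
        exact hv (F.mem_rootChildren.2 ⟨w, hw, h⟩)
  · intro F hF G hG hFG
    obtain ⟨hFR, hFC⟩ := (mem_filter.1 (mem_coe.1 hF)).2
    obtain ⟨hGR, hGC⟩ := (mem_filter.1 (mem_coe.1 hG)).2
    obtain ⟨h1, h2⟩ := Prod.mk.inj hFG
    ext1
    funext v
    by_cases hv : v ∈ C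
    · obtain ⟨r, -, hr⟩ := F.mem_rootChildren.1 (hFC ▸ hv)
      obtain ⟨s, -, hs⟩ := G.mem_rootChildren.1 (hGC ▸ hv)
      have h := congrFun h1 v
      simp only [hv, if_true, step, hr, hs, Option.getD_some] at h
      rw [hr, hs, h]
    · have h := congrArg (fun H => H.parent v) h2
      simpa [detach_parent, hv] using h
  · rintro ⟨g, G⟩ hgG
    simp only [coe_product, Set.mem_prod, mem_coe, Fintype.mem_piFinset, mem_filter, mem_univ,
      true_and] at hgG
    obtain ⟨hg, hGR, hG⟩ := hgG
    obtain ⟨ρ, hρ⟩ := G.exists_rank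
    have hgC (v : Fin m) (hv : v ∈ C) : g v ∈ R := by simpa [hv] using hg v
    have hRC (v : Fin m) (hv : v ∈ C) : v ∉ R := by simpa using hC hv
    have hroot (v : Fin m) : G.parent v = none ↔ v ∈ R ∨ v ∈ C := by
      rw [← mem_roots, hGR, mem_union]
    -- `R` drops to rank 0 and all other ranks rise by 1: the new edges from `C` to `R` decrease,
    -- and the old edges avoid `R`, which is childless in `G`.
    let F : RootedForest m := ofRank (fun v => if v ∈ C then some (g v) else G.parent v)
      (fun v => if v ∈ R then 0 else ρ v + 1) (by
        intro v w h
        by_cases hv : v ∈ C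
        · simp only [hv, if_true, Option.some.injEq] at h
          simp [← h, hgC v hv, hRC v hv]
        · simp only [hv, if_false] at h
          have hvR : v ∉ R := fun hvR => by simp [(hroot v).2 (Or.inl hvR)] at h
          have hwR : w ∉ R := fun hwR => hG v w hwR h
          simpa [hvR, hwR] using hρ v w h)
    have hF (v : Fin m) : F.parent v = if v ∈ C then some (g v) else G.parent v := rfl
    have hFR : F.roots = R := by
      ext v
      by_cases hv : v ∈ C
      · simp [mem_roots, hF, hv, hRC v hv]
      · simp [mem_roots, hF, hv, hroot]
    refine ⟨F, mem_coe.2 (mem_filter.2 ⟨mem_univ _, hFR, ?_⟩), ?_⟩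
    · ext v
      rw [mem_rootChildren, hFR]
      by_cases hv : v ∈ C
      · simpa [hF, hv] using hgC v hv
      · simp only [hF, hv, if_false, iff_false]
        rintro ⟨r, hr, h⟩
        exact hG v r hr h
    · refine Prod.ext (funext fun v => ?_) (RootedForest.ext (funext fun v => ?_))
      · by_cases hv : v ∈ C
        · simp [hv, step, hF]
        · have := hg v
          simp only [hv, if_false, mem_singleton] at this
          simp [hv, this]
      · by_cases hv : v ∈ C
        · simp [detach_parent, hv, (hroot v).2 (Or.inr hv)]
        · simp [detach_parent, hv, hF]
  · intro F hF
    obtain ⟨rfl, rfl⟩ := (mem_filter.1 hF).2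
    rw [← prod_mul_distrib]
    refine prod_congr rfl fun v _ => ?_
    by_cases hv : v ∈ F.rootChildren
    · obtain ⟨r, hr, h⟩ := F.mem_rootChildren.1 hv
      simp [hv, h, detach_parent, step]
    · simp [hv, detach_parent]

/-- The sum over the forests with root set `R` of the product of the weights of the parents. -/
noncomputable def forestSum (x : Fin m → K) (R : Finset (Fin m)) : K :=
  ∑ F : RootedForest m with F.roots = R, ∏ v, (F.parent v).elim 1 x

/-- Weight zero on `R` kills exactly the forests violating the condition, so the induction can stay
within `forestSum`. -/
theorem sum_childless_eq_forestSum (x : Fin m → K) (R D : Finset (Fin m)) :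
    ∑ F : RootedForest m with F.roots = D ∧ ∀ v, ∀ w ∈ R, F.parent v ≠ some w,
        ∏ v, (F.parent v).elim 1 x =
      forestSum (fun v => if v ∈ R then 0 else x v) D := by
  rw [forestSum, ← filter_filter, sum_filter]
  refine sum_congr rfl fun F _ => ?_
  split_ifs with h
  · refine prod_congr rfl fun v _ => ?_
    cases hp : F.parent v with
    | none => rfl
    | some w =>
      have hw : w ∉ R := fun hw => h v w hw hp
      simp [hw]
  · push Not at h
    obtain ⟨v, w, hw, hp⟩ := h
    exact (prod_eq_zero (mem_univ v) (by simp [hp, hw])).symm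

/-- Summing over fibres of constant `rootChildren` is what allows `Z` to depend on that whole set,
as the rule for v_min requires. -/
theorem sum_eq_sum_powerset_forestSum (R : Finset (Fin m)) (x : Fin m → K)
    (Z : Finset (Fin m) → Fin m → Fin m → K) :
    ∑ F : RootedForest m with F.roots = R,
        ∏ v, (F.parent v).elim 1 (if v ∈ F.rootChildren then Z F.rootChildren v else x) =
      ∑ C ∈ Rᶜ.powerset, (∏ c ∈ C, ∑ r ∈ R, Z C c r) *
        forestSum (fun v => if v ∈ R then 0 else x v) (R ∪ C) := by
  rw [← sum_fiberwise_of_maps_to (g := rootChildren) (t := Rᶜ.powerset)]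
  · refine sum_congr rfl fun C hC => ?_
    rw [← sum_childless_eq_forestSum, ← sum_rootChildren_eq R C (mem_powerset.1 hC), filter_filter]
    refine sum_congr rfl fun F hF => ?_
    rw [(mem_filter.1 hF).2.2]
  · intro F hF
    rw [mem_powerset, ← (mem_filter.1 hF).2]
    exact F.rootChildren_subset

theorem forestSum_univ (x : Fin m → K) : forestSum x univ = 1 := by
  let F : RootedForest m := ofRank (fun _ => none) (fun _ => 0) (by simp)
  rw [forestSum, sum_eq_single F]
  · exact prod_eq_one fun v _ => rfl
  · intro G hG hne
    refine absurd (RootedForest.ext (funext fun v => ?_)) hne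
    exact G.mem_roots.1 ((mem_filter.1 hG).2 ▸ mem_univ v)
  · intro h
    refine absurd (mem_filter.2 ⟨mem_univ _, ?_⟩) h
    ext v
    simp [mem_roots, F, ofRank]

theorem forestSum_eq_zero (x : Fin m → K) (R : Finset (Fin m)) (hR : Rᶜ.Nonempty)
    (hx : ∀ r ∈ R, x r = 0) : forestSum x R = 0 := by
  refine sum_eq_zero fun F hF => ?_
  obtain rfl := (mem_filter.1 hF).2
  obtain ⟨v, hv⟩ := F.rootChildren_nonempty hR
  obtain ⟨r, hr, h⟩ := F.mem_rootChildren.1 hv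
  exact prod_eq_zero (mem_univ v) (by simp [h, hx r hr])

theorem sum_ssubsets_mem (S : Finset (Fin m)) (s : ℕ) (hs : S.card = s + 1) (a X : K) (c : Fin m)
    (hc : c ∈ S) :
    ∑ C ∈ S.ssubsets with c ∈ C, a ^ (C.card - 1) * X ^ (S.card - C.card - 1) =
      ∑ j ∈ range s, (s.choose j : K) * (a ^ j * X ^ (s - j - 1)) := by
  have hT : (S.erase c).card = s := by rw [card_erase_of_mem hc, hs, Nat.add_sub_cancel]
  have h1 : ∑ C ∈ S.ssubsets with c ∈ C, a ^ (C.card - 1) * X ^ (S.card - C.card - 1) =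
      ∑ D ∈ (S.erase c).ssubsets, a ^ D.card * X ^ (s - D.card - 1) := by
    refine sum_nbij' (fun C => C.erase c) (fun D => insert c D) ?_ ?_ ?_ ?_ ?_
    · intro C hC
      obtain ⟨hC, hcC⟩ := mem_filter.1 hC
      rw [mem_ssubsets] at hC ⊢
      refine Finset.ssubset_iff_subset_ne.2 ⟨erase_subset_erase c hC.subset, fun h => hC.ne ?_⟩
      rw [← insert_erase hcC, h, insert_erase hc]
    · intro D hD
      rw [mem_ssubsets] at hD
      have hcD : c ∉ D := fun h => notMem_erase c S (hD.subset h)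
      refine mem_filter.2 ⟨mem_ssubsets.2 (Finset.ssubset_iff_subset_ne.2 ⟨?_, fun h => hD.ne ?_⟩),
        mem_insert_self c D⟩
      · exact insert_subset hc (hD.subset.trans (erase_subset c S))
      · rw [← h, erase_insert hcD]
    · intro C hC
      exact insert_erase (mem_filter.1 hC).2
    · intro D hD
      rw [mem_ssubsets] at hD
      exact erase_insert fun h => notMem_erase c S (hD.subset h)
    · intro C hC
      rw [card_erase_of_mem (mem_filter.1 hC).2, hs]
      have := card_pos.2 ⟨c, (mem_filter.1 hC).2⟩
      congr 2
      omega
  have h2 := sum_powerset_apply_card (x := S.erase c) fun j => a ^ j * X ^ (s - j - 1)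
  rw [hT, sum_range_succ, ← add_sum_erase _ _ (mem_powerset_self _), ← ssubsets, hT,
    Nat.choose_self, one_smul, add_comm] at h2
  rw [h1, add_right_cancel h2]
  simp [nsmul_eq_mul]

/-- After exchanging sums, every `c ∈ S` has the same coefficient (`sum_ssubsets_mem`). Multiplied
by ∑_S x, it gives all terms of the binomial expansion but the pure power of `a`, which comes from
`C = S`. -/
theorem sum_powerset_add_pow (S : Finset (Fin m)) (hS : S.Nonempty) (x : Fin m → K) (a : K) :
    ∑ C ∈ S.powerset with C.Nonempty, a ^ (C.card - 1) *
        (if C = S then 1 else (∑ c ∈ C, x c) * (∑ c ∈ S, x c) ^ (S.card - C.card - 1)) =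
      (a + ∑ c ∈ S, x c) ^ (S.card - 1) := by
  obtain ⟨s, hs⟩ : ∃ s, S.card = s + 1 := ⟨S.card - 1, by have := hS.card_pos; omega⟩
  set X := ∑ c ∈ S, x c with hX
  have hsplit : ∑ C ∈ S.powerset with C.Nonempty, a ^ (C.card - 1) *
        (if C = S then 1 else (∑ c ∈ C, x c) * X ^ (S.card - C.card - 1)) =
      a ^ s + ∑ C ∈ S.ssubsets, ∑ c ∈ C,
        x c * (a ^ (C.card - 1) * X ^ (S.card - C.card - 1)) := by
    rw [sum_filter, ← add_sum_erase _ _ (mem_powerset_self S), ← ssubsets, if_pos hS,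
      if_pos rfl, mul_one, hs, Nat.add_sub_cancel]
    refine congrArg _ (sum_congr rfl fun C hC => ?_)
    rw [mem_ssubsets] at hC
    rw [if_neg hC.ne, ← sum_mul]
    split_ifs with hne
    · ring
    · simp [not_nonempty_iff_eq_empty.1 hne]
  have hswap : ∑ C ∈ S.ssubsets, ∑ c ∈ C, x c * (a ^ (C.card - 1) * X ^ (S.card - C.card - 1)) =
      ∑ c ∈ S, ∑ C ∈ S.ssubsets with c ∈ C,
        x c * (a ^ (C.card - 1) * X ^ (S.card - C.card - 1)) := by
    refine sum_comm' fun C c => ?_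
    rw [mem_filter, mem_ssubsets]
    exact ⟨fun h => ⟨h, h.1.subset h.2⟩, fun h => h.1⟩
  rw [hsplit, hswap, sum_congr rfl fun c hc => by
    rw [← mul_sum, sum_ssubsets_mem S s hs a X c hc], ← sum_mul, ← hX, hs, Nat.add_sub_cancel,
    add_pow, sum_range_succ, mul_sum, add_comm]
  congr 1
  · refine sum_congr rfl fun j hj => ?_
    obtain ⟨i, hi⟩ : ∃ i, s - j = i + 1 := ⟨s - j - 1, by have := mem_range.1 hj; omega⟩
    rw [hi, Nat.add_sub_cancel]
    ring
  · simp

/-- If the children of the roots are weighted in such a way that any nonempty set of them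
contributes `b * a ^ (card - 1)`, the sum over the forests with roots `R` factors. -/
theorem sum_eq_mul_pow (R : Finset (Fin m)) (hR : Rᶜ.Nonempty) (x : Fin m → K)
    (Z : Finset (Fin m) → Fin m → Fin m → K) (b : K)
    (hZ : ∀ C ⊆ Rᶜ, C.Nonempty →
      ∏ c ∈ C, ∑ r ∈ R, Z C c r = b * (∑ r ∈ R, x r) ^ (C.card - 1))
    (ih : ∀ (y : Fin m → K) (D : Finset (Fin m)), Dᶜ.card < Rᶜ.card →
      forestSum y D = if Dᶜ = ∅ then 1 else (∑ r ∈ D, y r) * (∑ v, y v) ^ (Dᶜ.card - 1)) :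
    ∑ F : RootedForest m with F.roots = R,
        ∏ v, (F.parent v).elim 1 (if v ∈ F.rootChildren then Z F.rootChildren v else x) =
      b * (∑ v, x v) ^ (Rᶜ.card - 1) := by
  rw [sum_eq_sum_powerset_forestSum, ← sum_add_sum_compl R x,
    ← sum_powerset_add_pow _ hR, mul_sum, sum_filter]
  refine sum_congr rfl fun C hC => ?_
  rw [mem_powerset] at hC
  by_cases hne : C.Nonempty
  · rw [if_pos hne, hZ C hC hne]
    have hdisj : Disjoint R C := by
      rw [disjoint_left]
      intro v hv hvC
      exact mem_compl.1 (hC hvC) hv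
    have hcompl : (R ∪ C)ᶜ = Rᶜ \ C := by
      rw [compl_union, sdiff_eq_inter_compl]
    have hcard : (R ∪ C)ᶜ.card = Rᶜ.card - C.card := by
      rw [hcompl, card_sdiff_of_subset hC]
    have hle := card_le_card hC
    have hpos := hne.card_pos
    have hempty : (R ∪ C)ᶜ = ∅ ↔ C = Rᶜ := by
      rw [hcompl, sdiff_eq_empty_iff_subset]
      exact ⟨fun h => hC.antisymm h, fun h => h ▸ subset_rfl⟩
    -- With `R` weighted zero, the inductive formula sees only `C` among the roots and `Rᶜ` among
    -- all vertices.
    have h1 : ∑ r ∈ R ∪ C, (if r ∈ R then 0 else x r) = ∑ c ∈ C, x c := by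
      rw [sum_union hdisj, sum_eq_zero fun r hr => if_pos hr, zero_add]
      exact sum_congr rfl fun c hc => if_neg (mem_compl.1 (hC hc))
    have h2 : ∑ r, (if r ∈ R then 0 else x r) = ∑ c ∈ Rᶜ, x c := by
      rw [← sum_add_sum_compl R, sum_eq_zero fun r hr => if_pos hr, zero_add]
      exact sum_congr rfl fun c hc => if_neg (mem_compl.1 hc)
    rw [ih _ _ (by omega), h1, h2, hcard, mul_assoc]
    simp only [hempty]
  · obtain rfl := not_nonempty_iff_eq_empty.1 hne
    rw [if_neg hne, forestSum_eq_zero, mul_zero]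
    · simpa using hR
    · intro r hr
      simp at hr
      simp [hr]

/-- This is `sum_eq_mul_pow` with every `Z` equal to `x`. That lemma assumes the formula for smaller
complements, so it serves both here and, afterwards, for general `Z`. -/
theorem forestSum_eq (x : Fin m → K) (R : Finset (Fin m)) :
    forestSum x R =
      if Rᶜ = ∅ then 1 else (∑ r ∈ R, x r) * (∑ v, x v) ^ (Rᶜ.card - 1) := by
  induction hn : Rᶜ.card using Nat.strong_induction_on generalizing x R with
  | _ n ih =>
    split_ifs with h
    · rw [compl_eq_empty_iff] at h
      rw [h, forestSum_univ]
    · rw [← hn, ← sum_eq_mul_pow R (nonempty_iff_ne_empty.2 h) x (fun _ _ => x)]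
      · simp [forestSum]
      · intro C _ hC
        rw [prod_const, ← pow_succ', Nat.sub_add_cancel hC.card_pos]
      · intro y D hD
        exact ih _ (hn ▸ hD) y D rfl

theorem sum_forests_eq (R : Finset (Fin m)) (hR : Rᶜ.Nonempty) (x : Fin m → K)
    (Z : Finset (Fin m) → Fin m → Fin m → K) (b : K)
    (hZ : ∀ C ⊆ Rᶜ, C.Nonempty →
      ∏ c ∈ C, ∑ r ∈ R, Z C c r = b * (∑ r ∈ R, x r) ^ (C.card - 1)) :
    ∑ F : RootedForest m with F.roots = R,
        ∏ v, (F.parent v).elim 1 (if v ∈ F.rootChildren then Z F.rootChildren v else x) =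
      b * (∑ v, x v) ^ (Rᶜ.card - 1) :=
  sum_eq_mul_pow R hR x Z b hZ fun y D _ => forestSum_eq y D

end Sums

end RootedForest

/-! ### q-integers and q-binomials -/

section QAnalogues

theorem qInt_add (a b : ℕ) : qInt (a + b) = qInt a + RatFunc.X ^ a * qInt b := by
  simp [qInt, sum_range_add, pow_add, mul_sum]

theorem qInt_zero : qInt 0 = 0 := by simp [qInt]

theorem qInt_succ_ne_zero (n : ℕ) : qInt (n + 1) ≠ 0 := by
  have h : qInt (n + 1) =
      algebraMap (Polynomial ℚ) (RatFunc ℚ) (∑ i ∈ range (n + 1), Polynomial.X ^ i) := by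
    simp [qInt]
  rw [h, Ne, FaithfulSMul.algebraMap_eq_zero_iff]
  -- Evaluating at 1 gives `n + 1`.
  intro h0
  have h1 := congrArg (Polynomial.eval 1) h0
  simp only [Polynomial.eval_finsetSum, Polynomial.eval_pow, Polynomial.eval_X, one_pow,
    sum_const, card_range, nsmul_eq_mul, mul_one, Polynomial.eval_zero] at h1
  exact Nat.succ_ne_zero n (by exact_mod_cast h1)

theorem qFactorial_zero : qFactorial 0 = 1 := by simp [qFactorial]

theorem qFactorial_succ (n : ℕ) : qFactorial (n + 1) = qFactorial n * qInt (n + 1) := by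
  rw [qFactorial, prod_Icc_succ_top (by omega), qFactorial]

theorem qFactorial_ne_zero (n : ℕ) : qFactorial n ≠ 0 := by
  induction n with
  | zero => simp [qFactorial_zero]
  | succ n ih => rw [qFactorial_succ]; exact mul_ne_zero ih (qInt_succ_ne_zero n)

theorem qBinomial_add (a b : ℕ) :
    qBinomial (a + b) a = qFactorial (a + b) / (qFactorial a * qFactorial b) := by
  rw [qBinomial, if_pos (by omega), Nat.add_sub_cancel_left]

theorem qBinomial_eq_zero {n k : ℕ} (h : n < k) : qBinomial n k = 0 := by
  rw [qBinomial, if_neg (by omega)]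

theorem qBinomial_self (n : ℕ) : qBinomial n n = 1 := by
  have h := qBinomial_add n 0
  rw [Nat.add_zero, qFactorial_zero, mul_one, div_self (qFactorial_ne_zero n)] at h
  exact h

theorem qBinomial_zero_right (n : ℕ) : qBinomial n 0 = 1 := by
  have h := qBinomial_add 0 n
  rw [Nat.zero_add, qFactorial_zero, one_mul, div_self (qFactorial_ne_zero n)] at h
  exact h

theorem qInt_mul_qBinomial_succ (n k : ℕ) :
    qInt (k + 1) * qBinomial n (k + 1) = qInt (n - k) * qBinomial n k := by
  rcases lt_or_ge k n with h | h
  · obtain ⟨b, rfl⟩ := Nat.exists_eq_add_of_le h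
    have h1 := qBinomial_add (k + 1) b
    have h2 := qBinomial_add k (b + 1)
    rw [show k + (b + 1) = k + 1 + b by omega] at h2
    rw [h1, h2, show k + 1 + b - k = b + 1 by omega, qFactorial_succ k, qFactorial_succ b]
    have := qFactorial_ne_zero k
    have := qFactorial_ne_zero b
    have := qInt_succ_ne_zero k
    have := qInt_succ_ne_zero b
    field_simp
  · rw [qBinomial_eq_zero (by omega), Nat.sub_eq_zero_of_le h, qInt_zero, mul_zero, zero_mul]

/-- Multiplied by [k+1]_q, this reduces to [n+1]_q = [n-k]_q + q^(n-k) [k+1]_q. -/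
theorem qBinomial_succ_succ (n k : ℕ) (h : k ≤ n) :
    qBinomial (n + 1) (k + 1) = qBinomial n (k + 1) + RatFunc.X ^ (n - k) * qBinomial n k := by
  obtain ⟨b, rfl⟩ := Nat.exists_eq_add_of_le h
  have h1 := qBinomial_add (k + 1) b
  rw [show k + 1 + b = k + b + 1 by omega, qFactorial_succ (k + b), qFactorial_succ k] at h1
  have h2 := qBinomial_add k b
  have h3 := qInt_mul_qBinomial_succ (k + b) k
  have h4 := qInt_add b (k + 1)
  rw [Nat.add_sub_cancel_left] at h3 ⊢
  have hk := qInt_succ_ne_zero k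
  have hk' := qFactorial_ne_zero k
  have hb' := qFactorial_ne_zero b
  refine mul_left_cancel₀ hk ?_
  rw [mul_add, h3, h1, h2, show k + b + 1 = b + (k + 1) by omega, h4]
  field_simp

end QAnalogues

/-! ### Inversions of subsets and q-binomials -/

section SubsetSums

/-- The number of pairs of an element of `R` and a smaller element of the complement of `R`. -/
def compInv {m : ℕ} (R : Finset (Fin m)) : ℕ :=
  ∑ v ∈ R, (univ.filter fun w => w ∉ R ∧ w < v).card

theorem sum_finset_fin_succ {M : Type*} [AddCommMonoid M] (n : ℕ)
    (h : Finset (Fin (n + 1)) → M) :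
    ∑ R, h R = ∑ R : Finset (Fin n), h (R.map Fin.castSuccEmb) +
      ∑ R : Finset (Fin n), h (insert (Fin.last n) (R.map Fin.castSuccEmb)) := by
  have hnot : Fin.last n ∉ (univ : Finset (Fin n)).map Fin.castSuccEmb := by
    simp [Fin.castSucc_ne_last]
  have huniv : (univ : Finset (Fin (n + 1))) =
      insert (Fin.last n) (univ.map Fin.castSuccEmb) := by
    rw [Fin.univ_castSuccEmb, cons_eq_insert]
  rw [← powerset_univ, huniv, sum_powerset_insert hnot, ← powerset_univ]
  have hmap : ((univ : Finset (Fin n)).map Fin.castSuccEmb).powerset =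
      (univ : Finset (Fin n)).powerset.map (mapEmbedding Fin.castSuccEmb).toEmbedding := by
    refine Finset.ext fun D => ?_
    simp only [mem_powerset, mem_map, subset_map_iff]
    simp [eq_comm]
  rw [hmap, sum_map, sum_map]
  rfl

variable {n : ℕ} (R : Finset (Fin n))

theorem last_notMem_map : Fin.last n ∉ R.map Fin.castSuccEmb := by
  simp [Fin.castSucc_ne_last]

theorem card_insert_last_map :
    (insert (Fin.last n) (R.map Fin.castSuccEmb)).card = R.card + 1 := by
  rw [card_insert_of_notMem (last_notMem_map R), card_map]

theorem card_filter_lt_castSucc (T : Finset (Fin (n + 1)))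
    (hT : ∀ w : Fin n, w.castSucc ∈ T ↔ w ∈ R) (v : Fin n) :
    (univ.filter fun w => w ∉ T ∧ w < v.castSucc).card =
      (univ.filter fun w => w ∉ R ∧ w < v).card := by
  rw [← card_map (f := Fin.castSuccEmb) (s := univ.filter fun w => w ∉ R ∧ w < v)]
  refine congrArg card (Finset.ext fun w => ?_)
  refine Fin.lastCases ?_ (fun w => ?_) w
  · simp [Fin.castSucc_ne_last, not_lt_of_ge (Fin.le_last _)]
  · simp [hT]

theorem compInv_map : compInv (R.map Fin.castSuccEmb) = compInv R := by
  rw [compInv, sum_map]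
  exact sum_congr rfl fun v _ => card_filter_lt_castSucc R _ (by simp) v

theorem compInv_insert_last_map :
    compInv (insert (Fin.last n) (R.map Fin.castSuccEmb)) = compInv R + (n - R.card) := by
  rw [compInv, sum_insert (last_notMem_map R), sum_map, add_comm]
  congr 1
  · exact sum_congr rfl fun v _ =>
      card_filter_lt_castSucc R _ (by simp [Fin.castSucc_ne_last]) v
  · have h : (univ.filter fun w => w ∉ insert (Fin.last n) (R.map Fin.castSuccEmb) ∧
        w < Fin.last n) = Rᶜ.map Fin.castSuccEmb := by
      ext w
      refine Fin.lastCases ?_ (fun w => ?_) w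
      · simp [Fin.castSucc_ne_last]
      · simp [Fin.castSucc_ne_last, Fin.castSucc_lt_last]
    rw [h, card_map, card_compl, Fintype.card_fin]

/-- Splitting on membership of the last element reproduces the q-Pascal rule: when it lies in the
set, it exceeds every non-member. -/
theorem sum_pow_compInv (n k : ℕ) :
    ∑ R : Finset (Fin n), (if R.card = k then (RatFunc.X : RatFunc ℚ) ^ compInv R else 0) =
      qBinomial n k := by
  induction n generalizing k with
  | zero =>
    rw [Fintype.sum_eq_single (∅ : Finset (Fin 0)) fun R hR => (hR (Subsingleton.elim _ _)).elim]
    cases k with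
    | zero => simp [qBinomial_self, compInv]
    | succ k => simp [qBinomial_eq_zero]
  | succ n ih =>
    rw [sum_finset_fin_succ]
    simp only [card_map, compInv_map, card_insert_last_map, compInv_insert_last_map, ih]
    cases k with
    | zero => simp [qBinomial_zero_right]
    | succ k =>
      have h : ∑ R : Finset (Fin n), (if R.card + 1 = k + 1 then
          (RatFunc.X : RatFunc ℚ) ^ (compInv R + (n - R.card)) else 0) =
          RatFunc.X ^ (n - k) * qBinomial n k := by
        rw [← ih, mul_sum]
        refine sum_congr rfl fun R _ => ?_
        by_cases hR : R.card = k
        · simp [hR, pow_add, mul_comm]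
        · simp [hR]
      rw [h]
      rcases le_or_gt k n with hk | hk
      · rw [qBinomial_succ_succ n k hk]
      · rw [qBinomial_eq_zero hk, qBinomial_eq_zero (by omega), qBinomial_eq_zero (by omega),
          mul_zero, add_zero]

theorem sum_pow_card_lt {α : Type*} [LinearOrder α] (R : Finset α) :
    ∑ r ∈ R, (RatFunc.X : RatFunc ℚ) ^ (R.filter fun s => s < r).card = qInt R.card := by
  induction R using Finset.induction_on_max with
  | empty => simp [qInt_zero]
  | insert a s hlt ih =>
    have ha : a ∉ s := fun h => lt_irrefl a (hlt a h)
    rw [sum_insert ha, card_insert_of_notMem ha, qInt_add, ← ih, add_comm]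
    congr 1
    · refine sum_congr rfl fun r hr => ?_
      rw [filter_insert, if_neg (hlt r hr).not_gt]
    · rw [filter_insert, if_neg (lt_irrefl a), filter_true_of_mem hlt]
      simp [qInt]

end SubsetSums

/-! ### Weights encoding the statistics and the leaf condition -/

section Weights

variable {n : ℕ}

/-- The weight of a parent: `q ^ (label - 1)`, or `0` for the last vertex. -/
noncomputable def vertexWeight (v : Fin (n + 1)) : RatFunc ℚ :=
  if v = Fin.last n then 0 else RatFunc.X ^ (v : ℕ)

/-- The weight of a root as the parent of the smallest child of the roots: `q` to the power of
its index among the roots `R`, or `0` for the last vertex. -/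
noncomputable def rootWeight (R : Finset (Fin (n + 1))) (r : Fin (n + 1)) : RatFunc ℚ :=
  if r = Fin.last n then 0 else RatFunc.X ^ (R.filter fun s => s < r).card

open Classical in
/-- The weight of `r` as the parent of the element `c` of the set `C` of children of the roots. -/
noncomputable def childWeight (R C : Finset (Fin (n + 1))) (c : Fin (n + 1)) :
    Fin (n + 1) → RatFunc ℚ :=
  if ∀ w ∈ C, c ≤ w then rootWeight R else vertexWeight

theorem sum_vertexWeight : ∑ v : Fin (n + 1), vertexWeight v = qInt n := by
  rw [Fin.sum_univ_castSucc]
  simp only [vertexWeight, Fin.castSucc_ne_last, if_false, if_true, Fin.val_castSucc, add_zero]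
  exact Fin.sum_univ_eq_sum_range (fun i => (RatFunc.X : RatFunc ℚ) ^ i) n

theorem sum_rootWeight_map (R : Finset (Fin n)) :
    ∑ r ∈ R.map Fin.castSuccEmb, rootWeight (R.map Fin.castSuccEmb) r = qInt R.card := by
  rw [← card_map Fin.castSuccEmb, ← sum_pow_card_lt]
  refine sum_congr rfl fun r hr => ?_
  rw [rootWeight, if_neg]
  rintro rfl
  exact last_notMem_map R hr

/-- The last vertex has weight 0 and, being the largest, does not shift the index of any other root.
-/
theorem sum_rootWeight_insert_last_map (R : Finset (Fin n)) :
    ∑ r ∈ insert (Fin.last n) (R.map Fin.castSuccEmb),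
      rootWeight (insert (Fin.last n) (R.map Fin.castSuccEmb)) r = qInt R.card := by
  rw [sum_insert (last_notMem_map R), ← sum_rootWeight_map]
  nth_rewrite 1 [rootWeight]
  rw [if_pos rfl, zero_add]
  refine sum_congr rfl fun r _ => ?_
  rw [rootWeight, rootWeight, filter_insert, if_neg (not_lt_of_ge (Fin.le_last r))]

/-- Only the minimum of `C` uses `rootWeight`. This is the hypothesis on `Z` in `sum_forests_eq`. -/
theorem prod_sum_childWeight (R C : Finset (Fin (n + 1))) (hC : C.Nonempty) :
    ∏ c ∈ C, ∑ r ∈ R, childWeight R C c r =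
      (∑ r ∈ R, rootWeight R r) * (∑ r ∈ R, vertexWeight r) ^ (C.card - 1) := by
  have hmin : ∀ w ∈ C, C.min' hC ≤ w := fun w hw => min'_le C w hw
  rw [← mul_prod_erase C _ (min'_mem C hC), childWeight, if_pos hmin,
    ← card_erase_of_mem (min'_mem C hC), ← prod_const]
  refine congrArg _ (prod_congr rfl fun c hc => ?_)
  rw [childWeight, if_neg]
  exact fun h => ne_of_mem_erase hc ((h _ (min'_mem C hC)).antisymm (hmin c (mem_of_mem_erase hc)))

end Weights

/-! ### Forest weights in terms of the statistics -/

namespace RootedForest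

variable {n : ℕ} (F : RootedForest (n + 1))

theorem mem_smallestRootChild {v : Fin (n + 1)} :
    v ∈ F.smallestRootChild ↔ v ∈ F.rootChildren ∧ ∀ w ∈ F.rootChildren, v ≤ w := by
  simp [smallestRootChild]

theorem mem_remaining {v : Fin (n + 1)} :
    v ∈ F.remaining ↔ v ∉ F.roots ∧ v ∉ F.smallestRootChild := by
  simp [remaining]

/-- The product of the weights of the parents of all non-root vertices. -/
noncomputable def weight : RatFunc ℚ :=
  ∏ v, (F.parent v).elim 1
    (if v ∈ F.rootChildren then childWeight F.roots F.rootChildren v else vertexWeight)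

theorem weight_of_isLeaf (hF : F.IsLeaf (Fin.last n)) :
    F.weight = RatFunc.X ^ (F.scindex + ∑ v ∈ F.remaining, (F.parentLabel v - 1)) := by
  have h1 : F.scindex = ∑ v, if v ∈ F.smallestRootChild then
      (F.roots.filter fun r => ∃ p, F.parent v = some p ∧ r < p).card else 0 := by
    rw [sum_ite_mem, univ_inter, scindex]
  have h2 : ∑ v ∈ F.remaining, (F.parentLabel v - 1) =
      ∑ v, if v ∈ F.remaining then F.parentLabel v - 1 else 0 := by
    rw [sum_ite_mem, univ_inter]
  rw [h1, h2, ← sum_add_distrib, ← prod_pow_eq_pow_sum, weight]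
  refine prod_congr rfl fun v _ => ?_
  cases hp : F.parent v with
  | none =>
    have hv : v ∈ F.roots := F.mem_roots.2 hp
    have hs : v ∉ F.smallestRootChild := fun h =>
      mem_compl.1 (F.rootChildren_subset (F.mem_smallestRootChild.1 h).1) hv
    simp [hs, mem_remaining, hv]
  | some w =>
    have hv : v ∉ F.roots := by simp [mem_roots, hp]
    have hw : w ≠ Fin.last n := fun h => hF v (h ▸ hp)
    by_cases hs : v ∈ F.smallestRootChild
    · have hc := F.mem_smallestRootChild.1 hs
      have hr : v ∉ F.remaining := fun h => (F.mem_remaining.1 h).2 hs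
      simp only [Option.elim_some, if_pos hc.1, childWeight, if_pos hc.2, rootWeight, if_neg hw,
        if_pos hs, if_neg hr, add_zero, Option.some.injEq, exists_eq_left']
    · have hr : v ∈ F.remaining := F.mem_remaining.2 ⟨hv, hs⟩
      have hwt : (if v ∈ F.rootChildren then childWeight F.roots F.rootChildren v
          else vertexWeight) = vertexWeight := by
        split_ifs with hc
        · exact if_neg fun h => hs (F.mem_smallestRootChild.2 ⟨hc, h⟩)
        · rfl
      simp [hwt, hs, hr, vertexWeight, hw, parentLabel, hp]

theorem weight_of_not_isLeaf (hF : ¬F.IsLeaf (Fin.last n)) : F.weight = 0 := by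
  rw [IsLeaf] at hF
  push Not at hF
  obtain ⟨v, hv⟩ := hF
  refine prod_eq_zero (mem_univ v) ?_
  simp only [hv, Option.elim_some, childWeight]
  split_ifs <;> simp [rootWeight, vertexWeight]

theorem card_remaining (k : ℕ) (hk : F.roots.card = k + 1) : F.remaining.card = n - k - 1 := by
  have h1 : F.remaining = F.rootsᶜ \ F.smallestRootChild := by
    ext v
    simp [mem_remaining]
  have h2 : F.smallestRootChild ⊆ F.rootsᶜ :=
    (filter_subset _ _).trans F.rootChildren_subset
  have h3 : F.rootsᶜ.card = n - k := by
    rw [card_compl, Fintype.card_fin, hk]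
    omega
  rw [h1, card_sdiff_of_subset h2, h3]
  -- Without non-roots there is no v_min to remove, and the truncated `n - k - 1` is 0 as well.
  rcases F.rootsᶜ.eq_empty_or_nonempty with h | h
  · rw [h, card_empty] at h3
    omega
  · have hC := F.rootChildren_nonempty h
    have : F.smallestRootChild = {F.rootChildren.min' hC} := by
      ext v
      rw [mem_smallestRootChild, mem_singleton]
      constructor
      · rintro ⟨hv, hmin⟩
        exact (hmin _ (min'_mem _ hC)).antisymm (min'_le _ _ hv)
      · rintro rfl
        exact ⟨min'_mem _ hC, fun w hw => min'_le _ _ hw⟩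
    rw [this, card_singleton]

/-- Remaining vertices have parents, so their parent labels are at least 1 and the subtraction does
not truncate. -/
theorem parents_eq : F.parents = ∑ v ∈ F.remaining, (F.parentLabel v - 1) + F.remaining.card := by
  rw [parents, card_eq_sum_ones, ← sum_add_distrib]
  refine sum_congr rfl fun v hv => (Nat.sub_add_cancel ?_).symm
  cases hp : F.parent v with
  | none => exact absurd (F.mem_roots.2 hp) (F.mem_remaining.1 hv).1
  | some w => simp [parentLabel, hp]

theorem zpow_eq_pow (k : ℕ) (hk : F.roots.card = k + 1) :
    (RatFunc.X : RatFunc ℚ) ^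
        ((F.niblings : ℤ) + (F.scindex : ℤ) + (F.parents : ℤ) - max ((n : ℤ) - (k : ℤ) - 1) 0) =
      RatFunc.X ^ compInv F.roots *
        RatFunc.X ^ (F.scindex + ∑ v ∈ F.remaining, (F.parentLabel v - 1)) := by
  have hn : F.niblings = compInv F.roots := by
    simp only [niblings, compInv, lowerNonroots]
  have h := F.parents_eq
  have hr := F.card_remaining k hk
  rw [← pow_add, ← zpow_natCast]
  congr 1
  rw [← hn]
  generalize ∑ v ∈ F.remaining, (F.parentLabel v - 1) = t at h ⊢
  omega

theorem sum_weight (R : Finset (Fin (n + 1))) (hR : Rᶜ.Nonempty) :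
    ∑ F : RootedForest (n + 1) with F.roots = R, F.weight =
      (∑ r ∈ R, rootWeight R r) * qInt n ^ (Rᶜ.card - 1) := by
  rw [← sum_vertexWeight, ← sum_forests_eq R hR vertexWeight (childWeight R) _
    fun C _ hC => prod_sum_childWeight R C hC]
  refine sum_congr rfl fun F hF => ?_
  rw [weight, (mem_filter.1 hF).2]

end RootedForest

/-! ### Summation over root sets -/

open RootedForest

/-- The leaf condition can be dropped because forests violating it have weight 0. -/
theorem sum_leafForests_eq (n k : ℕ) :
    ∑ F ∈ leafForests n k,
        (RatFunc.X : RatFunc ℚ) ^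
          ((F.niblings : ℤ) + (F.scindex : ℤ) + (F.parents : ℤ) - max ((n : ℤ) - (k : ℤ) - 1) 0) =
      ∑ R : Finset (Fin (n + 1)), if R.card = k + 1 then
        RatFunc.X ^ compInv R * ∑ F : RootedForest (n + 1) with F.roots = R, F.weight else 0 := by
  classical
  rw [leafForests, ← filter_filter, sum_filter,
    ← sum_fiberwise (s := univ.filter _) (g := RootedForest.roots)]
  refine sum_congr rfl fun R _ => ?_
  split_ifs with hR
  · rw [mul_sum, filter_filter]
    refine sum_congr ?_ fun F hF => ?_
    · refine filter_congr fun F _ => ?_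
      rw [numComponents_eq]
      exact ⟨fun h => h.2, fun h => ⟨h ▸ hR, h⟩⟩
    · obtain rfl := (mem_filter.1 hF).2
      split_ifs with hl
      · rw [F.zpow_eq_pow k hR, F.weight_of_isLeaf hl]
      · rw [F.weight_of_not_isLeaf hl, mul_zero]
  · refine sum_eq_zero fun F hF => ?_
    obtain ⟨hF, rfl⟩ := mem_filter.1 hF
    have h := (mem_filter.1 (mem_filter.1 hF).1).2
    rw [numComponents_eq] at h
    exact absurd h hR

theorem sum_leafForests_of_lt {n k : ℕ} (h : k < n) :
    ∑ F ∈ leafForests n k,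
        (RatFunc.X : RatFunc ℚ) ^
          ((F.niblings : ℤ) + (F.scindex : ℤ) + (F.parents : ℤ) - max ((n : ℤ) - (k : ℤ) - 1) 0) =
      qBinomial n k * qInt n ^ (n - k) := by
  have hterm (R : Finset (Fin (n + 1))) (hR : R.card = k + 1) :
      ∑ F : RootedForest (n + 1) with F.roots = R, F.weight =
        (∑ r ∈ R, rootWeight R r) * qInt n ^ (n - k - 1) := by
    have hc : Rᶜ.card = n - k := by
      rw [card_compl, Fintype.card_fin, hR]
      omega
    rw [sum_weight R (card_pos.1 (by omega)), hc]
  have h1 : ∑ R : Finset (Fin n), (if (R.map Fin.castSuccEmb).card = k + 1 then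
        RatFunc.X ^ compInv (R.map Fin.castSuccEmb) *
          ∑ F : RootedForest (n + 1) with F.roots = R.map Fin.castSuccEmb, F.weight else 0) =
      qBinomial n (k + 1) * (qInt (k + 1) * qInt n ^ (n - k - 1)) := by
    rw [← sum_pow_compInv, sum_mul]
    refine sum_congr rfl fun R _ => ?_
    by_cases hR : R.card = k + 1
    · rw [hterm _ (by rw [card_map, hR]), sum_rootWeight_map, compInv_map, card_map, if_pos hR,
        if_pos hR, hR]
    · rw [card_map, if_neg hR, if_neg hR, zero_mul]
  have h2 : ∑ R : Finset (Fin n),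
        (if (insert (Fin.last n) (R.map Fin.castSuccEmb)).card = k + 1 then
        RatFunc.X ^ compInv (insert (Fin.last n) (R.map Fin.castSuccEmb)) *
          ∑ F : RootedForest (n + 1) with
            F.roots = insert (Fin.last n) (R.map Fin.castSuccEmb), F.weight else 0) =
      qBinomial n k * (RatFunc.X ^ (n - k) * (qInt k * qInt n ^ (n - k - 1))) := by
    rw [← sum_pow_compInv, sum_mul]
    refine sum_congr rfl fun R _ => ?_
    by_cases hR : R.card = k
    · rw [hterm _ (by rw [card_insert_last_map, hR]), sum_rootWeight_insert_last_map,
        compInv_insert_last_map, card_insert_last_map, if_pos (by rw [hR]), if_pos hR, hR, pow_add,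
        mul_assoc]
    · rw [card_insert_last_map, if_neg (by omega), if_neg hR, zero_mul]
  rw [sum_leafForests_eq, sum_finset_fin_succ, h1, h2]
  have h3 := qInt_mul_qBinomial_succ n k
  have h4 := qInt_add (n - k) k
  rw [Nat.sub_add_cancel h.le] at h4
  obtain ⟨d, hd⟩ : ∃ d, n - k = d + 1 := ⟨n - k - 1, by omega⟩
  rw [hd] at h3 h4 ⊢
  rw [Nat.add_sub_cancel, pow_succ]
  -- `h3` turns the term with n+1 not a root into [n-k]_q binom(n,k)_q; `h4` then merges [n-k]_q +
  -- q^(n-k) [k]_q into [n]_q.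
  linear_combination qInt n ^ d * h3 - qBinomial n k * qInt n ^ d * h4

theorem sum_leafForests_of_ge {n k : ℕ} (h : n ≤ k) :
    ∑ F ∈ leafForests n k,
        (RatFunc.X : RatFunc ℚ) ^
          ((F.niblings : ℤ) + (F.scindex : ℤ) + (F.parents : ℤ) - max ((n : ℤ) - (k : ℤ) - 1) 0) =
      qBinomial n k * qInt n ^ (n - k) := by
  rw [sum_leafForests_eq, Nat.sub_eq_zero_of_le h, pow_zero, mul_one]
  rcases h.lt_or_eq with h | rfl
  · rw [qBinomial_eq_zero h]
    refine sum_eq_zero fun R _ => if_neg ?_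
    have := card_le_univ R
    rw [Fintype.card_fin] at this
    omega
  -- For k = n every vertex is a root, so `sum_weight` does not apply; only the edgeless forest
  -- remains, with weight 1.
  · have hu : (univ : Finset (Fin (n + 1))).card = n + 1 := by simp
    rw [qBinomial_self, Fintype.sum_eq_single univ, if_pos hu]
    · have hw : ∑ F : RootedForest (n + 1) with F.roots = univ, F.weight = 1 := by
        rw [← forestSum_univ (vertexWeight (n := n)), forestSum]
        refine sum_congr rfl fun F hF => prod_congr rfl fun v _ => ?_
        have hv : F.parent v = none := F.mem_roots.1 ((mem_filter.1 hF).2 ▸ mem_univ v)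
        simp [hv]
      simp [hw, compInv]
    · intro R hR
      refine if_neg fun hc => hR ?_
      rwa [← card_eq_iff_eq_univ, Fintype.card_fin]

theorem corollary3p3 (n k : ℕ) :
    qTrees n k =
        ∑ F ∈ leafForests n k,
          (RatFunc.X : RatFunc ℚ) ^
            ((F.niblings : ℤ) + (F.scindex : ℤ) + (F.parents : ℤ) - max ((n : ℤ) - (k : ℤ) - 1) 0) ∧
      ∑ F ∈ leafForests n k,
          (RatFunc.X : RatFunc ℚ) ^
            ((F.niblings : ℤ) + (F.scindex : ℤ) + (F.parents : ℤ) - max ((n : ℤ) - (k : ℤ) - 1) 0) =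
        qBinomial n k * qInt n ^ (n - k) := by
  have h : ∑ F ∈ leafForests n k,
          (RatFunc.X : RatFunc ℚ) ^
            ((F.niblings : ℤ) + (F.scindex : ℤ) + (F.parents : ℤ) - max ((n : ℤ) - (k : ℤ) - 1) 0) =
        qBinomial n k * qInt n ^ (n - k) :=
    (lt_or_ge k n).elim sum_leafForests_of_lt sum_leafForests_of_ge
  exact ⟨h.symm, h⟩
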